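/- Let $P_0$ be the uniform distribution on $[0,1]$, let $P_0^n$ be its $n$-fold product, and let $f$ be a probability density on $[0,1]$ (with respect to $P_0$) with $f\in L_2[0,1]$. Let $\theta_n\in(0,1)$, $\theta_n\to 0$ and $n\theta_n^2\to\infty$ as $n\to\infty$, and put $p_{\theta_n}(t)=1-\theta_n+\theta_n f(t)$, $$e_{0n}=\int_0^1\log p_{\theta_n}(t)\,dt,\qquad \sigma_{0n}^2=\int_0^1\log^2 p_{\theta_n}(t)\,dt-e_{0n}^2,\quad \sigma_{0n}\ge 0,$$ and, for $X_1,\dots,X_n$ with values in $[0,1]$, $$V_n=\frac{1}{\sqrt n\,\sigma_{0n}}\sum_{i=1}^n\bigl(\log p_{\theta_n}(X_i)-e_{0n}\bigr).$$ Then for every $\delta\in(0,1/2)$ and every sequence $x_n$ with $2\delta\sigma_{0n}<x_n<2(1-\delta)\sigma_{0n}$ for all $n\ge 1$, $$-\lim_{n\to\infty}\frac{1}{n x_n^2}\log P_0^n\bigl(V_n\ge\sqrt n\,x_n\bigr)=\frac12 .$$ -/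

import Mathlib

open Filter Topology MeasureTheory

namespace NPTest

/-- The null distribution `P₀`: the uniform distribution over `[0,1]`. -/
noncomputable def P0 : Measure ℝ := volume.restrict (Set.Icc 0 1)

instance : IsProbabilityMeasure P0 := ⟨by simp [P0]⟩

/-- The `n`-fold product `P₀ⁿ`: the law of an i.i.d. sample `(X₁, …, Xₙ)` under the null. -/
noncomputable def P0n (n : ℕ) : Measure (Fin n → ℝ) := Measure.pi fun _ => P0

/-- The local alternative density `p_θ(t) = 1 - θ + θ f(t)`. -/
def p (f : ℝ → ℝ) (θ t : ℝ) : ℝ := 1 - θ + θ * f t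

/-- The mean of `log p_θ(X₁)` under `P₀`. -/
noncomputable def e0 (f : ℝ → ℝ) (θ : ℝ) : ℝ := ∫ t, Real.log (p f θ t) ∂P0

/-- The standard deviation of `log p_θ(X₁)` under `P₀`. -/
noncomputable def sigma0 (f : ℝ → ℝ) (θ : ℝ) : ℝ :=
  Real.sqrt ((∫ t, (Real.log (p f θ t)) ^ 2 ∂P0) - (e0 f θ) ^ 2)

/-- The standardized Neyman-Pearson statistic at the sample `X = (X₁, …, Xₙ)`. -/
noncomputable def V (f : ℝ → ℝ) (θ : ℝ) (n : ℕ) (X : Fin n → ℝ) : ℝ :=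
  1 / (Real.sqrt n * sigma0 f θ) * ∑ i, (Real.log (p f θ (X i)) - e0 f θ)

end NPTest

/-! Write `L = log p_θ`, `S = ∑ (L(X_i) - e0)`, `A = n σ²` and `y = x/σ`. The event is `S ≥ A y`,
and the claim is that its log-probability is `-A y²/2` up to `o(A)`, as for a Gaussian of variance
`A`.

Since `f ∈ L²`, `p_θ` has a finite second moment, so `exp (h L)` is integrable for `0 ≤ h ≤ 2`. On
`[0, H]` with `H < 2` the cubic Taylor remainder of `exp (h L)` is dominated by a multiple of `θ² (f
- 1)²` and is `o(θ²)`. As `σ² ~ θ² ∫ (f - 1)²`, the cumulant generating function of `S` is `A h²/2 +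
o(A)` uniformly on `[0, H]` (`eventually_abs_log_integral_exp_sub_le`), and `A → ∞` because `n θ² →
∞`.

Chernoff's bound at `h = y` gives the upper estimate. For the lower one, tilting by `y + ε`
concentrates `S` on `[A y, A (y + 2ε)]` (`mgf_le_exp_mul_tail_add`, `abs_log_tail_add_le`). The
window for `x` keeps `y` below `2`, where tilting is possible, and away from `0`, so that `o(A)` is
negligible against `A y²`. -/

namespace NPTest

/-! ### Elementary inequalities for `log` and `exp` -/

theorem abs_log_one_add_sub_le {u : ℝ} (hu : -1 / 2 ≤ u) : |Real.log (1 + u) - u| ≤ 2 * u ^ 2 := by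
  have hv : 0 < 1 + u := by linarith
  have h1 := Real.log_le_sub_one_of_pos hv
  have h2 := Real.one_sub_inv_le_log_of_pos hv
  have h3 : u - (1 - (1 + u)⁻¹) ≤ 2 * u ^ 2 := by
    have : u - (1 - (1 + u)⁻¹) = u ^ 2 / (1 + u) := by field_simp; ring
    rw [this, div_le_iff₀ hv]
    nlinarith [sq_nonneg u]
  rw [abs_le]
  constructor <;> nlinarith [sq_nonneg u]

theorem abs_log_one_add_le {u : ℝ} (hu : -1 / 2 ≤ u) : |Real.log (1 + u)| ≤ 2 * |u| := by
  have hv : 0 < 1 + u := by linarith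
  have h1 := Real.log_le_sub_one_of_pos hv
  have h2 := Real.one_sub_inv_le_log_of_pos hv
  have h3 : 1 - (1 + u)⁻¹ = u / (1 + u) := by field_simp; ring
  have h4 : -(2 * |u|) ≤ u / (1 + u) := by
    rw [le_div_iff₀ hv]
    rcases abs_cases u with ⟨h, h'⟩ | ⟨h, h'⟩ <;> rw [h] <;> nlinarith
  rw [abs_le]
  constructor
  · linarith
  · linarith [le_abs_self u, abs_nonneg u]

/-- Below exponent `2`, the cubic exponential moment of `log (1 + u)` is quadratic in `u`. -/
theorem exists_abs_log_pow_mul_exp_le {H : ℝ} (hH0 : 0 ≤ H) (hH : H < 2) :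
    ∃ C : ℝ, ∀ u : ℝ, -1 / 2 ≤ u →
      |Real.log (1 + u)| ^ 3 * Real.exp (H * |Real.log (1 + u)|) ≤ C * u ^ 2 := by
  -- With `v = 1 + u`, `log v ≤ v^ε / ε`; cubing costs `v^(3ε) = v^(2-H)`, which with `v^H` makes
  -- exactly `v²`.
  set ε := (2 - H) / 3 with hε
  have hε0 : 0 < ε := by rw [hε]; linarith
  refine ⟨4 * Real.exp 2 + 4 / ε ^ 3, fun u hu => ?_⟩
  have hv : 0 < 1 + u := by linarith
  have hL := abs_log_one_add_le hu
  set L := Real.log (1 + u) with hLdef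
  have hC : 0 < 4 / ε ^ 3 := by positivity
  rcases le_or_gt |L| 1 with h1 | h1
  · have : |L| ^ 3 * Real.exp (H * |L|) ≤ (2 * |u|) ^ 2 * Real.exp 2 := by
      gcongr
      · calc |L| ^ 3 ≤ |L| ^ 2 := pow_le_pow_of_le_one (abs_nonneg _) h1 (by norm_num)
          _ ≤ (2 * |u|) ^ 2 := by gcongr
      · nlinarith [abs_nonneg L]
    rw [mul_pow, sq_abs] at this
    nlinarith [mul_nonneg hC.le (sq_nonneg u)]
  -- Since `u ≥ -1/2` forces `L ≥ -1`, a large `|L|` means `L > 1`, hence `u ≥ 1` and `(1 + u)² ≤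
  -- 4u²`.
  · have hlow : -1 ≤ L := by
      have := Real.one_sub_inv_le_log_of_pos hv
      have h2 : (1 + u)⁻¹ ≤ 2 := by
        rw [inv_le_comm₀ hv (by norm_num)]; linarith
      linarith
    have hLpos : 1 < L := by
      rcases abs_cases L with ⟨h, h'⟩ | ⟨h, h'⟩ <;> linarith
    have hu1 : 1 ≤ u := by
      have := Real.log_le_sub_one_of_pos hv
      linarith
    rw [abs_of_pos (by linarith)]
    have hlog : L ≤ Real.exp (ε * L) / ε := by
      have := Real.log_le_rpow_div hv.le hε0
      rwa [Real.rpow_def_of_pos hv, mul_comm] at this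
    have key : L ^ 3 * Real.exp (H * L) ≤ (1 + u) ^ 2 / ε ^ 3 := by
      calc L ^ 3 * Real.exp (H * L) ≤ (Real.exp (ε * L) / ε) ^ 3 * Real.exp (H * L) := by
            gcongr
        _ = (Real.exp L) ^ 2 / ε ^ 3 := by
            rw [div_pow, ← Real.exp_nat_mul, ← Real.exp_nat_mul, div_mul_eq_mul_div, ← Real.exp_add]
            congr 2
            rw [hε]; push_cast; ring
        _ = _ := by rw [hLdef, Real.exp_log hv]
    refine key.trans ?_
    have : (1 + u) ^ 2 / ε ^ 3 ≤ 4 / ε ^ 3 * u ^ 2 := by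
      rw [div_mul_eq_mul_div]
      gcongr
      nlinarith
    nlinarith [mul_nonneg (Real.exp_pos 2).le (sq_nonneg u)]

theorem abs_exp_sub_quadratic_le (x : ℝ) :
    |Real.exp x - (1 + x + x ^ 2 / 2)| ≤ |x| ^ 3 * Real.exp |x| := by
  have := Complex.norm_exp_sub_sum_le_norm_mul_exp (x : ℂ) 3
  simp only [Finset.sum_range_succ, Finset.sum_range_zero] at this
  norm_num [Nat.factorial] at this
  have h2 : Complex.exp x - (1 + x + x ^ 2 / 2) = ((Real.exp x - (1 + x + x ^ 2 / 2) : ℝ) : ℂ) := by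
    push_cast; ring
  rw [h2, Complex.norm_real] at this
  exact this

/-! ### Nondegeneracy, integrability and mean of `log p_θ` -/

theorem integral_sq_sub_one_pos {f : ℝ → ℝ} (hf : MemLp f 2 P0) {θ : ℝ} (hσ : sigma0 f θ ≠ 0) :
    0 < ∫ t, (f t - 1) ^ 2 ∂P0 := by
  have hg : MemLp (fun t => f t - 1) 2 P0 := hf.sub (memLp_const 1)
  refine lt_of_le_of_ne (integral_nonneg fun t => sq_nonneg _) fun h => hσ ?_
  have h0 := (integral_eq_zero_iff_of_nonneg (fun t => sq_nonneg _) hg.integrable_sq).1 h.symm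
  have h1 : ∀ᵐ t ∂P0, Real.log (p f θ t) = 0 := by
    filter_upwards [h0] with t ht
    have : f t = 1 := by
      have : (f t - 1) ^ 2 = 0 := ht
      nlinarith [pow_eq_zero_iff (two_ne_zero) |>.1 this]
    simp [p, this]
  have h2 : e0 f θ = 0 := integral_eq_zero_of_ae h1
  have h3 : ∫ t, (Real.log (p f θ t)) ^ 2 ∂P0 = 0 :=
    integral_eq_zero_of_ae (by filter_upwards [h1] with t ht; simp [ht])
  simp [sigma0, h2, h3]

theorem p_eq_one_add (f : ℝ → ℝ) (θ t : ℝ) : p f θ t = 1 + θ * (f t - 1) := by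
  simp only [p]; ring

theorem aestronglyMeasurable_log_p {f : ℝ → ℝ} (hf : MemLp f 2 P0) (θ : ℝ) :
    AEStronglyMeasurable (fun t => Real.log (p f θ t)) P0 := by
  unfold p
  exact (Real.measurable_log.comp_aemeasurable
    ((hf.1.aemeasurable.const_mul θ).const_add (1 - θ))).aestronglyMeasurable

/-- For `0 ≤ h ≤ 2`, `p^h ≤ 1 + p²`, which is integrable because `f ∈ L²`. -/
theorem integrable_exp_mul_log_p {f : ℝ → ℝ} (hf : MemLp f 2 P0)
    (hf0 : ∀ᵐ t ∂P0, 0 ≤ f t) {θ : ℝ} (hθ : θ ∈ Set.Ioo (0 : ℝ) 1) {h : ℝ} (h0 : 0 ≤ h)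
    (h2 : h ≤ 2) : Integrable (fun t => Real.exp (h * Real.log (p f θ t))) P0 := by
  have hp : MemLp (fun t => p f θ t) 2 P0 := (memLp_const (1 - θ)).add (hf.const_mul θ)
  refine Integrable.mono' ((integrable_const 1).add hp.integrable_sq)
    (Real.continuous_exp.comp_aestronglyMeasurable
      ((aestronglyMeasurable_log_p hf θ).const_mul h)) ?_
  filter_upwards [hf0] with t ht
  have hpos : 0 < p f θ t := by
    unfold p; nlinarith [mul_nonneg hθ.1.le ht, hθ.2]
  simp only [Real.norm_eq_abs, Real.abs_exp, Pi.add_apply]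
  rcases le_total (Real.log (p f θ t)) 0 with hl | hl
  · have : Real.exp (h * Real.log (p f θ t)) ≤ 1 :=
      Real.exp_le_one_iff.2 (mul_nonpos_of_nonneg_of_nonpos h0 hl)
    nlinarith [sq_nonneg (p f θ t)]
  · have : Real.exp (h * Real.log (p f θ t)) ≤ (p f θ t) ^ 2 := by
      calc _ ≤ Real.exp (2 * Real.log (p f θ t)) := by gcongr
        _ = _ := by
          rw [← Nat.cast_two, Real.exp_nat_mul, Real.exp_log hpos]
    linarith

theorem neg_half_le_mul_sub_one {a θ : ℝ} (ha : 0 ≤ a) (hθ0 : 0 < θ) (hθ : θ ≤ 1 / 2) :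
    -1 / 2 ≤ θ * (a - 1) := by nlinarith [mul_nonneg hθ0.le ha]

theorem memLp_log_p {f : ℝ → ℝ} (hf : MemLp f 2 P0)
    (hf0 : ∀ᵐ t ∂P0, 0 ≤ f t) {θ : ℝ} (hθ0 : 0 < θ) (hθ : θ ≤ 1 / 2) :
    MemLp (fun t => Real.log (p f θ t)) 2 P0 := by
  have hg : MemLp (fun t => f t - 1) 2 P0 := hf.sub (memLp_const 1)
  refine hg.of_le_mul (c := 2 * θ) (aestronglyMeasurable_log_p hf θ) ?_
  filter_upwards [hf0] with t ht
  rw [p_eq_one_add, Real.norm_eq_abs, Real.norm_eq_abs]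
  refine (abs_log_one_add_le (neg_half_le_mul_sub_one ht hθ0 hθ)).trans_eq ?_
  rw [abs_mul, abs_of_pos hθ0]; ring

/-- The linear term `θ (f - 1)` has mean zero because `∫ f = 1`, so the mean is of second order in
`θ`. -/
theorem abs_e0_le {f : ℝ → ℝ} (hf : MemLp f 2 P0) (hf0 : ∀ᵐ t ∂P0, 0 ≤ f t)
    (hf1 : ∫ t, f t ∂P0 = 1) {θ : ℝ} (hθ0 : 0 < θ) (hθ : θ ≤ 1 / 2) :
    |e0 f θ| ≤ 2 * θ ^ 2 * ∫ t, (f t - 1) ^ 2 ∂P0 := by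
  have hg : MemLp (fun t => f t - 1) 2 P0 := hf.sub (memLp_const 1)
  have hfi : Integrable f P0 := hf.integrable (by norm_num)
  have hgi : Integrable (fun t => f t - 1) P0 := hg.integrable (by norm_num)
  have hLi := (memLp_log_p hf hf0 hθ0 hθ).integrable (by norm_num)
  have hg0 : ∫ t, θ * (f t - 1) ∂P0 = 0 := by
    rw [integral_const_mul, integral_sub hfi (integrable_const _), hf1]; simp
  have : e0 f θ = ∫ t, (Real.log (p f θ t) - θ * (f t - 1)) ∂P0 := by
    rw [integral_sub hLi (hgi.const_mul θ), hg0, sub_zero]; rfl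
  rw [this, ← integral_const_mul, ← Real.norm_eq_abs]
  refine norm_integral_le_of_norm_le (hg.integrable_sq.const_mul _) ?_
  filter_upwards [hf0] with t ht
  rw [p_eq_one_add, Real.norm_eq_abs]
  refine (abs_log_one_add_sub_le (neg_half_le_mul_sub_one ht hθ0 hθ)).trans_eq ?_
  ring

/-! ### Exponential tilting -/

/-- The mass that `exp (h * S)` puts outside `[a, b]` is controlled by the moment generating
function at `h ± η`; what remains is bounded by the upper tail of `S`. -/
theorem mgf_le_exp_mul_tail_add {Ω : Type*} [MeasurableSpace Ω] {μ : Measure Ω}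
    [IsProbabilityMeasure μ] {S : Ω → ℝ} (hS : AEMeasurable S μ) {h η a b : ℝ} (hh : 0 ≤ h)
    (hη : 0 ≤ η) (h1 : Integrable (fun ω => Real.exp (h * S ω)) μ)
    (h2 : Integrable (fun ω => Real.exp ((h - η) * S ω)) μ)
    (h3 : Integrable (fun ω => Real.exp ((h + η) * S ω)) μ) :
    ProbabilityTheory.mgf S μ h ≤ Real.exp (h * b) * μ.real {ω | a ≤ S ω}
      + Real.exp (η * a) * ProbabilityTheory.mgf S μ (h - η)
      + Real.exp (-(η * b)) * ProbabilityTheory.mgf S μ (h + η) := by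
  have hset : NullMeasurableSet {ω | a ≤ S ω} μ := nullMeasurableSet_le aemeasurable_const hS
  have hind : Integrable (Set.indicator {ω | a ≤ S ω} fun _ => Real.exp (h * b)) μ :=
    (integrable_const _).indicator₀ hset
  have heq : Real.exp (h * b) * μ.real {ω | a ≤ S ω}
      = ∫ ω, Set.indicator {ω | a ≤ S ω} (fun _ => Real.exp (h * b)) ω ∂μ := by
    rw [integral_indicator₀ hset, setIntegral_const, smul_eq_mul, mul_comm]
  have h2' := h2.const_mul (Real.exp (η * a))
  have h3' := h3.const_mul (Real.exp (-(η * b)))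
  simp only [ProbabilityTheory.mgf]
  rw [heq, ← integral_const_mul, ← integral_const_mul, ← integral_add hind h2',
    ← integral_add (by exact hind.add h2') h3']
  refine integral_mono h1 ((hind.add h2').add h3') fun ω => ?_
  beta_reduce
  have e2 := Real.exp_pos ((h - η) * S ω)
  have e3 := Real.exp_pos ((h + η) * S ω)
  have e4 := Real.exp_pos (η * a)
  have e5 := Real.exp_pos (-(η * b))
  by_cases ha : a ≤ S ω
  · rw [Set.indicator_of_mem (by exact ha)]
    rcases le_total (S ω) b with hb | hb
    · have : Real.exp (h * S ω) ≤ Real.exp (h * b) := by gcongr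
      have := mul_pos e4 e2
      have := mul_pos e5 e3
      linarith
    · have : Real.exp (h * S ω) ≤ Real.exp (-(η * b)) * Real.exp ((h + η) * S ω) := by
        rw [← Real.exp_add]; apply Real.exp_le_exp.2; nlinarith
      have := mul_pos e4 e2
      have := Real.exp_pos (h * b)
      linarith
  · rw [Set.indicator_of_notMem (by exact ha)]
    have : Real.exp (h * S ω) ≤ Real.exp (η * a) * Real.exp ((h - η) * S ω) := by
      rw [← Real.exp_add]; apply Real.exp_le_exp.2; nlinarith
    have := mul_pos e5 e3
    linarith

/-! ### Moments of `log p_θ` as `θ → 0` -/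

section asymptotics

variable {f : ℝ → ℝ} {θ : ℕ → ℝ}

theorem eventually_le_half (hlim : Tendsto θ atTop (𝓝 0)) : ∀ᶠ n in atTop, θ n ≤ 1 / 2 :=
  hlim.eventually_le_const (by norm_num)

theorem tendsto_log_p_div (hpos : ∀ᶠ n in atTop, 0 < θ n) (hlim : Tendsto θ atTop (𝓝 0))
    {t : ℝ} (ht : 0 ≤ f t) :
    Tendsto (fun n => Real.log (p f (θ n) t) / θ n) atTop (𝓝 (f t - 1)) := by
  rw [tendsto_iff_norm_sub_tendsto_zero]
  have h0 : Tendsto (fun n => 2 * (f t - 1) ^ 2 * θ n) atTop (𝓝 0) := by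
    simpa using hlim.const_mul (2 * (f t - 1) ^ 2)
  refine squeeze_zero' (Eventually.of_forall fun n => norm_nonneg _) ?_ h0
  filter_upwards [hpos, eventually_le_half hlim] with n h1 h2
  have := abs_log_one_add_sub_le (neg_half_le_mul_sub_one ht h1 h2)
  rw [p_eq_one_add, Real.norm_eq_abs]
  have e : Real.log (1 + θ n * (f t - 1)) / θ n - (f t - 1)
      = (Real.log (1 + θ n * (f t - 1)) - θ n * (f t - 1)) / θ n := by field_simp
  rw [e, abs_div, abs_of_pos h1, div_le_iff₀ h1]
  nlinarith

theorem tendsto_log_p (hpos : ∀ᶠ n in atTop, 0 < θ n) (hlim : Tendsto θ atTop (𝓝 0))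
    {t : ℝ} (ht : 0 ≤ f t) :
    Tendsto (fun n => Real.log (p f (θ n) t)) atTop (𝓝 0) := by
  have := (tendsto_log_p_div hpos hlim ht).mul hlim
  rw [mul_zero] at this
  refine this.congr' ?_
  filter_upwards [hpos] with n hn
  field_simp

theorem tendsto_integral_log_p_sq_div (hf : MemLp f 2 P0) (hf0 : ∀ᵐ t ∂P0, 0 ≤ f t)
    (hpos : ∀ᶠ n in atTop, 0 < θ n) (hlim : Tendsto θ atTop (𝓝 0)) :
    Tendsto (fun n => (∫ t, Real.log (p f (θ n) t) ^ 2 ∂P0) / θ n ^ 2) atTop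
      (𝓝 (∫ t, (f t - 1) ^ 2 ∂P0)) := by
  have hg : MemLp (fun t => f t - 1) 2 P0 := hf.sub (memLp_const 1)
  simp_rw [← integral_div, ← div_pow]
  refine tendsto_integral_filter_of_dominated_convergence (fun t => 4 * (f t - 1) ^ 2)
    (Eventually.of_forall fun n => ?_) ?_ (hg.integrable_sq.const_mul 4) ?_
  · simp only [div_eq_mul_inv]
    exact ((aestronglyMeasurable_log_p hf (θ n)).mul_const _).pow 2
  · filter_upwards [hpos, eventually_le_half hlim] with n h1 h2
    filter_upwards [hf0] with t ht
    have := abs_log_one_add_le (neg_half_le_mul_sub_one ht h1 h2)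
    rw [p_eq_one_add, Real.norm_eq_abs, abs_of_nonneg (sq_nonneg _), ← sq_abs, abs_div,
      abs_of_pos h1, ← sq_abs (f t - 1)]
    have h3 : |Real.log (1 + θ n * (f t - 1))| / θ n ≤ 2 * |f t - 1| := by
      rw [div_le_iff₀ h1]
      rw [abs_mul, abs_of_pos h1] at this
      linarith
    calc _ ≤ (2 * |f t - 1|) ^ 2 := by gcongr
      _ = _ := by ring
  · filter_upwards [hf0] with t ht
    exact (tendsto_log_p_div hpos hlim ht).pow 2

theorem integrable_abs_log_p_pow_mul_exp (hf : MemLp f 2 P0) (hf0 : ∀ᵐ t ∂P0, 0 ≤ f t)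
    {H : ℝ} (hH0 : 0 ≤ H) (hH : H < 2) {θ : ℝ} (hθ0 : 0 < θ) (hθ : θ ≤ 1 / 2) :
    Integrable (fun t => |Real.log (p f θ t)| ^ 3 * Real.exp (H * |Real.log (p f θ t)|)) P0 := by
  have hg : MemLp (fun t => f t - 1) 2 P0 := hf.sub (memLp_const 1)
  obtain ⟨C, hC⟩ := exists_abs_log_pow_mul_exp_le hH0 hH
  refine Integrable.mono' (hg.integrable_sq.const_mul (C * θ ^ 2)) ?_ ?_
  · have := aestronglyMeasurable_log_p hf θ
    exact (this.norm.pow 3).mul (Real.continuous_exp.comp_aestronglyMeasurable (this.norm.const_mul H))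
  · filter_upwards [hf0] with t ht
    rw [Real.norm_eq_abs, abs_of_nonneg (by positivity), p_eq_one_add]
    refine (hC _ (neg_half_le_mul_sub_one ht hθ0 hθ)).trans_eq ?_
    ring

/-- No third moment of `f` is needed: the integrand over `θ²` is dominated by `C (f - 1)²`, and
pointwise it is `(L/θ)² |L| exp (H |L|) → 0`. -/
theorem tendsto_integral_abs_log_p_pow_mul_exp_div (hf : MemLp f 2 P0)
    (hf0 : ∀ᵐ t ∂P0, 0 ≤ f t) {H : ℝ} (hH0 : 0 ≤ H) (hH : H < 2)
    (hpos : ∀ᶠ n in atTop, 0 < θ n) (hlim : Tendsto θ atTop (𝓝 0)) :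
    Tendsto (fun n => (∫ t, |Real.log (p f (θ n) t)| ^ 3
      * Real.exp (H * |Real.log (p f (θ n) t)|) ∂P0) / θ n ^ 2) atTop (𝓝 0) := by
  have hg : MemLp (fun t => f t - 1) 2 P0 := hf.sub (memLp_const 1)
  obtain ⟨C, hC⟩ := exists_abs_log_pow_mul_exp_le hH0 hH
  simp_rw [← integral_div]
  have h0 : (0 : ℝ) = ∫ _ : ℝ, (0 : ℝ) ∂P0 := by simp
  rw [h0]
  refine tendsto_integral_filter_of_dominated_convergence (fun t => C * (f t - 1) ^ 2)
    (Eventually.of_forall fun n => ?_) ?_ (hg.integrable_sq.const_mul C) ?_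
  · have := aestronglyMeasurable_log_p hf (θ n)
    simp only [div_eq_mul_inv]
    exact ((this.norm.pow 3).mul
      (Real.continuous_exp.comp_aestronglyMeasurable (this.norm.const_mul H))).mul_const _
  · filter_upwards [hpos, eventually_le_half hlim] with n h1 h2
    filter_upwards [hf0] with t ht
    rw [Real.norm_eq_abs, abs_of_nonneg (by positivity), p_eq_one_add, div_le_iff₀ (by positivity)]
    refine (hC _ (neg_half_le_mul_sub_one ht h1 h2)).trans_eq ?_
    ring
  · filter_upwards [hf0] with t ht
    have h1 := (tendsto_log_p_div hpos hlim ht).pow 2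
    have h2 := (tendsto_log_p hpos hlim ht).abs
    have h3 := (Real.continuous_exp.tendsto _).comp (h2.const_mul H)
    have h4 := (h1.mul h2).mul h3
    simp only [abs_zero, mul_zero, zero_mul] at h4
    refine h4.congr fun n => ?_
    simp only [Function.comp]
    rw [div_pow, ← sq_abs (Real.log (p f (θ n) t))]
    ring

theorem tendsto_e0_div (hf : MemLp f 2 P0) (hf0 : ∀ᵐ t ∂P0, 0 ≤ f t) (hf1 : ∫ t, f t ∂P0 = 1)
    (hpos : ∀ᶠ n in atTop, 0 < θ n) (hlim : Tendsto θ atTop (𝓝 0)) :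
    Tendsto (fun n => e0 f (θ n) / θ n) atTop (𝓝 0) := by
  have h0 : Tendsto (fun n => 2 * (∫ t, (f t - 1) ^ 2 ∂P0) * θ n) atTop (𝓝 0) := by
    simpa using hlim.const_mul (2 * ∫ t, (f t - 1) ^ 2 ∂P0)
  refine squeeze_zero_norm' ?_ h0
  filter_upwards [hpos, eventually_le_half hlim] with n h1 h2
  have := abs_e0_le hf hf0 hf1 h1 h2
  rw [Real.norm_eq_abs, abs_div, abs_of_pos h1, div_le_iff₀ h1]
  linarith

theorem sigma0_sq (hf : MemLp f 2 P0) (hf0 : ∀ᵐ t ∂P0, 0 ≤ f t) {θ : ℝ} (hθ0 : 0 < θ)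
    (hθ : θ ≤ 1 / 2) :
    sigma0 f θ ^ 2 = (∫ t, Real.log (p f θ t) ^ 2 ∂P0) - e0 f θ ^ 2 := by
  have h := memLp_log_p hf hf0 hθ0 hθ
  refine Real.sq_sqrt ?_
  have h1 := ProbabilityTheory.variance_nonneg (fun t => Real.log (p f θ t)) P0
  rw [ProbabilityTheory.variance_eq_sub h] at h1
  exact h1

theorem tendsto_sigma0_sq_div (hf : MemLp f 2 P0) (hf0 : ∀ᵐ t ∂P0, 0 ≤ f t)
    (hf1 : ∫ t, f t ∂P0 = 1)
    (hpos : ∀ᶠ n in atTop, 0 < θ n) (hlim : Tendsto θ atTop (𝓝 0)) :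
    Tendsto (fun n => sigma0 f (θ n) ^ 2 / θ n ^ 2) atTop (𝓝 (∫ t, (f t - 1) ^ 2 ∂P0)) := by
  have := (tendsto_integral_log_p_sq_div hf hf0 hpos hlim).sub
    ((tendsto_e0_div hf hf0 hf1 hpos hlim).pow 2)
  rw [zero_pow two_ne_zero, sub_zero] at this
  refine this.congr' ?_
  filter_upwards [hpos, eventually_le_half hlim] with n h1 h2
  rw [sigma0_sq hf hf0 h1 h2, div_pow, sub_div]

/-- Second order expansion of the exponential moment of `log p`, with explicit remainder. -/
theorem abs_integral_exp_mul_log_p_sub_le (hf : MemLp f 2 P0) (hf0 : ∀ᵐ t ∂P0, 0 ≤ f t)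
    {θ : ℝ} (hθ0 : 0 < θ) (hθ : θ ≤ 1 / 2) {H h : ℝ} (hH : H < 2) (h0 : 0 ≤ h) (hh : h ≤ H) :
    |(∫ t, Real.exp (h * Real.log (p f θ t)) ∂P0)
        - (1 + h * e0 f θ + h ^ 2 / 2 * ∫ t, Real.log (p f θ t) ^ 2 ∂P0)|
      ≤ 8 * ∫ t, |Real.log (p f θ t)| ^ 3 * Real.exp (H * |Real.log (p f θ t)|) ∂P0 := by
  have hL := memLp_log_p hf hf0 hθ0 hθ
  have hLi : Integrable (fun t => Real.log (p f θ t)) P0 := hL.integrable (by norm_num)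
  have hE := integrable_exp_mul_log_p hf hf0 ⟨hθ0, by linarith⟩ h0 (by linarith)
  have hD := integrable_abs_log_p_pow_mul_exp hf hf0 (h0.trans hh) hH hθ0 hθ
  have h1 : Integrable (fun t => 1 + h * Real.log (p f θ t)) P0 :=
    (integrable_const 1).add (hLi.const_mul h)
  have h2 : Integrable (fun t => h ^ 2 / 2 * Real.log (p f θ t) ^ 2) P0 :=
    hL.integrable_sq.const_mul _
  have eq : (∫ t, Real.exp (h * Real.log (p f θ t)) ∂P0)
        - (1 + h * e0 f θ + h ^ 2 / 2 * ∫ t, Real.log (p f θ t) ^ 2 ∂P0)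
      = ∫ t, (Real.exp (h * Real.log (p f θ t))
        - (1 + h * Real.log (p f θ t) + h ^ 2 / 2 * Real.log (p f θ t) ^ 2)) ∂P0 := by
    rw [integral_sub hE (by exact h1.add h2), integral_add h1 h2,
      integral_add (integrable_const 1) (hLi.const_mul h), integral_const_mul, integral_const_mul]
    simp [e0]
  rw [eq, ← integral_const_mul, ← Real.norm_eq_abs]
  refine norm_integral_le_of_norm_le (hD.const_mul 8) (Eventually.of_forall fun t => ?_)
  set L := Real.log (p f θ t)
  have := abs_exp_sub_quadratic_le (h * L)
  rw [Real.norm_eq_abs]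
  calc _ = |Real.exp (h * L) - (1 + h * L + (h * L) ^ 2 / 2)| := by congr 1; ring
    _ ≤ |h * L| ^ 3 * Real.exp |h * L| := this
    _ = h ^ 3 * |L| ^ 3 * Real.exp (h * |L|) := by rw [abs_mul, abs_of_nonneg h0]; ring
    _ ≤ 2 ^ 3 * |L| ^ 3 * Real.exp (H * |L|) := by gcongr; linarith
    _ = _ := by ring

/-- All errors are `o(θ²)` with bounds free of `h`, and `σ² ~ θ² ∫ (f - 1)²` with a positive
integral absorbs them. -/
theorem eventually_abs_log_integral_exp_sub_le (hf : MemLp f 2 P0) (hf0 : ∀ᵐ t ∂P0, 0 ≤ f t)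
    (hf1 : ∫ t, f t ∂P0 = 1) (hG : 0 < ∫ t, (f t - 1) ^ 2 ∂P0)
    {H : ℝ} (hH0 : 0 ≤ H) (hH : H < 2)
    (hpos : ∀ᶠ n in atTop, 0 < θ n) (hlim : Tendsto θ atTop (𝓝 0)) {κ : ℝ} (hκ : 0 < κ) :
    ∀ᶠ n in atTop, ∀ h, 0 ≤ h → h ≤ H →
      |Real.log (∫ t, Real.exp (h * Real.log (p f (θ n) t)) ∂P0) - h * e0 f (θ n)
        - h ^ 2 / 2 * sigma0 f (θ n) ^ 2| ≤ κ * sigma0 f (θ n) ^ 2 := by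
  set G := ∫ t, (f t - 1) ^ 2 ∂P0
  set e := fun n => e0 f (θ n) with he
  set m := fun n => ∫ t, Real.log (p f (θ n) t) ^ 2 ∂P0 with hm
  set D := fun n => ∫ t, |Real.log (p f (θ n) t)| ^ 3
      * Real.exp (H * |Real.log (p f (θ n) t)|) ∂P0 with hD
  have te : Tendsto (fun n => e n / θ n) atTop (𝓝 0) := tendsto_e0_div hf hf0 hf1 hpos hlim
  have tm : Tendsto (fun n => m n / θ n ^ 2) atTop (𝓝 G) :=
    tendsto_integral_log_p_sq_div hf hf0 hpos hlim
  have tD : Tendsto (fun n => D n / θ n ^ 2) atTop (𝓝 0) :=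
    tendsto_integral_abs_log_p_pow_mul_exp_div hf hf0 hH0 hH hpos hlim
  have tσ := tendsto_sigma0_sq_div hf hf0 hf1 hpos hlim
  -- `W` bounds the distance of the exponential moment from `1`, uniformly in `h ≤ H < 2`.
  set W := fun n => 2 * |e n| + 2 * m n + 8 * D n with hW
  have tW : Tendsto (fun n => W n / θ n) atTop (𝓝 0) := by
    have := ((te.abs.const_mul 2).add ((tm.mul hlim).const_mul 2)).add ((tD.mul hlim).const_mul 8)
    simp only [abs_zero, mul_zero, add_zero] at this
    refine this.congr' ?_
    filter_upwards [hpos] with n hn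
    rw [abs_div, abs_of_pos hn]
    simp only [hW]
    field_simp
  have tW0 : Tendsto W atTop (𝓝 0) := by
    have := tW.mul hlim
    rw [mul_zero] at this
    refine this.congr' ?_
    filter_upwards [hpos] with n hn
    field_simp
  -- The three errors: linearizing `log`, the Taylor remainder, and replacing the second moment by
  -- the variance.
  have tT : Tendsto (fun n => (2 * W n ^ 2 + 8 * D n + 2 * e n ^ 2) / θ n ^ 2) atTop (𝓝 0) := by
    have := (((tW.pow 2).const_mul 2).add (tD.const_mul 8)).add ((te.pow 2).const_mul 2)
    simp only [ne_eq, OfNat.ofNat_ne_zero, not_false_eq_true, zero_pow, mul_zero, add_zero] at this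
    refine this.congr fun n => ?_
    ring
  have hT : ∀ᶠ n in atTop, (2 * W n ^ 2 + 8 * D n + 2 * e n ^ 2) / θ n ^ 2
      ≤ κ * (sigma0 f (θ n) ^ 2 / θ n ^ 2) :=
    (tT.eventually_lt (tσ.const_mul κ) (mul_pos hκ hG)).mono fun n hn => hn.le
  filter_upwards [hpos, eventually_le_half hlim, hT,
    tW0.eventually_le_const (show (0 : ℝ) < 1 / 2 by norm_num)] with n h1 h2 hTn hWn h h0 hh
  have hr := abs_integral_exp_mul_log_p_sub_le hf hf0 h1 h2 hH h0 hh
  have hs := sigma0_sq hf hf0 h1 h2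
  have hm0 : 0 ≤ m n := integral_nonneg fun t => sq_nonneg _
  have hTn' : 2 * W n ^ 2 + 8 * D n + 2 * e n ^ 2 ≤ κ * sigma0 f (θ n) ^ 2 := by
    rw [← mul_div_assoc] at hTn
    exact (div_le_div_iff_of_pos_right (by positivity)).1 hTn
  change |_ - (1 + h * e n + h ^ 2 / 2 * m n)| ≤ 8 * D n at hr
  change sigma0 f (θ n) ^ 2 = m n - e n ^ 2 at hs
  set I := ∫ t, Real.exp (h * Real.log (p f (θ n) t)) ∂P0
  have hh2 : h ^ 2 ≤ 4 := by nlinarith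
  have hwW : |I - 1| ≤ W n := by
    have e1 : |h * e n| ≤ 2 * |e n| := by
      rw [abs_mul, abs_of_nonneg h0]
      exact mul_le_mul_of_nonneg_right (by linarith) (abs_nonneg _)
    have e2 : |h ^ 2 / 2 * m n| ≤ 2 * m n := by
      rw [abs_of_nonneg (by positivity)]
      exact mul_le_mul_of_nonneg_right (by linarith) hm0
    have : I - 1 = h * e n + h ^ 2 / 2 * m n + (I - (1 + h * e n + h ^ 2 / 2 * m n)) := by ring
    rw [this]
    exact (abs_add_three _ _ _).trans (by simp only [hW]; linarith)
  have hlog := abs_log_one_add_sub_le (u := I - 1) (by linarith [(abs_le.1 hwW).1])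
  rw [add_sub_cancel] at hlog
  have hsq : (I - 1) ^ 2 ≤ W n ^ 2 := sq_le_sq' (abs_le.1 hwW).1 (abs_le.1 hwW).2
  have he2 : |h ^ 2 / 2 * e n ^ 2| ≤ 2 * e n ^ 2 := by
    rw [abs_of_nonneg (by positivity)]
    exact mul_le_mul_of_nonneg_right (by linarith) (sq_nonneg _)
  have : Real.log I - h * e n - h ^ 2 / 2 * sigma0 f (θ n) ^ 2
      = (Real.log I - (I - 1)) + (I - (1 + h * e n + h ^ 2 / 2 * m n)) + h ^ 2 / 2 * e n ^ 2 := by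
    rw [hs]; ring
  change |Real.log I - h * e n - _| ≤ _
  rw [this]
  exact (abs_add_three _ _ _).trans (by linarith)

end asymptotics

/-! ### Exponential moments of i.i.d. sums -/

section sums

theorem exp_mul_sum_sub {E : Type*} (n : ℕ) (h c : ℝ) (g : E → ℝ) (X : Fin n → E) :
    Real.exp (h * ∑ i, (g (X i) - c)) = ∏ i, Real.exp (-(h * c)) * Real.exp (h * g (X i)) := by
  rw [Finset.mul_sum, Real.exp_sum]
  refine Finset.prod_congr rfl fun i _ => ?_
  rw [← Real.exp_add]; ring_nf

variable {E : Type*} [MeasurableSpace E] {μ : Measure E} [IsProbabilityMeasure μ]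

theorem integrable_exp_mul_sum_sub (n : ℕ) {h : ℝ} (c : ℝ) {g : E → ℝ}
    (hg : Integrable (fun t => Real.exp (h * g t)) μ) :
    Integrable (fun X : Fin n → E => Real.exp (h * ∑ i, (g (X i) - c)))
      (Measure.pi fun _ => μ) := by
  simp_rw [exp_mul_sum_sub]
  exact Integrable.fintype_prod fun i => hg.const_mul _

theorem log_mgf_sum_sub (n : ℕ) {h : ℝ} (c : ℝ) {g : E → ℝ}
    (hg : Integrable (fun t => Real.exp (h * g t)) μ) :
    Real.log (ProbabilityTheory.mgf (fun X : Fin n → E => ∑ i, (g (X i) - c))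
      (Measure.pi fun _ => μ) h) = n * (Real.log (∫ t, Real.exp (h * g t) ∂μ) - h * c) := by
  have hI := integral_exp_pos hg
  unfold ProbabilityTheory.mgf
  simp_rw [exp_mul_sum_sub]
  rw [integral_fintype_prod_eq_pow (fun t => Real.exp (-(h * c)) * Real.exp (h * g t)),
    integral_const_mul, Real.log_pow, Real.log_mul (Real.exp_ne_zero _) hI.ne', Real.log_exp,
    Fintype.card_fin]
  ring

end sums

/-! ### Logarithmic tail asymptotics -/

/-- A nearly Gaussian cumulant generating function gives Gaussian tails on the logarithmic scale. -/
theorem abs_log_tail_add_le {Ω : Type*} [MeasurableSpace Ω] {μ : Measure Ω}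
    [IsProbabilityMeasure μ] {S : Ω → ℝ} (hS : AEMeasurable S μ) {A ε y : ℝ} (hA : 0 < A)
    (hε : 0 < ε) (hε1 : ε ≤ 1) (hAε : 8 ≤ A * ε ^ 2) (hy : 0 ≤ y) (hyH : y + 2 * ε ≤ 2)
    (hint : ∀ h, 0 ≤ h → h ≤ y + 2 * ε → Integrable (fun ω => Real.exp (h * S ω)) μ)
    (hcgf : ∀ h, 0 ≤ h → h ≤ y + 2 * ε →
      |Real.log (ProbabilityTheory.mgf S μ h) - A * h ^ 2 / 2| ≤ ε ^ 2 / 8 * A) :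
    |Real.log (μ.real {ω | A * y ≤ S ω}) + A * y ^ 2 / 2| ≤ 6 * ε * A := by
  have ey : (y + ε) - ε = y := by ring
  have ey2 : (y + ε) + ε = y + 2 * ε := by ring
  have i1 := hint y hy (by linarith)
  have i2 := hint (y + ε) (by linarith) (by linarith)
  have i3 := hint (y + 2 * ε) (by linarith) le_rfl
  have c1 := abs_le.1 (hcgf y hy (by linarith))
  have c2 := abs_le.1 (hcgf (y + ε) (by linarith) (by linarith))
  have c3 := abs_le.1 (hcgf (y + 2 * ε) (by linarith) le_rfl)
  have p1 := ProbabilityTheory.mgf_pos i1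
  have p2 := ProbabilityTheory.mgf_pos i2
  have p3 := ProbabilityTheory.mgf_pos i3
  have up := ProbabilityTheory.measure_ge_le_exp_mul_mgf (A * y) hy i1
  have low := mgf_le_exp_mul_tail_add hS (h := y + ε) (η := ε) (a := A * y)
    (b := A * (y + 2 * ε)) (by linarith) hε.le i2 (by rwa [ey]) (by rwa [ey2])
  rw [ey, ey2] at low
  set M1 := ProbabilityTheory.mgf S μ y
  set M2 := ProbabilityTheory.mgf S μ (y + ε)
  set M3 := ProbabilityTheory.mgf S μ (y + 2 * ε)
  set Q := μ.real {ω | A * y ≤ S ω}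
  have quarter : Real.exp (-2) ≤ 1 / 4 := by
    rw [Real.exp_neg, inv_le_comm₀ (Real.exp_pos _) (by norm_num)]
    have : Real.exp 2 = Real.exp 1 ^ 2 := by rw [← Real.exp_nat_mul]; norm_num
    rw [this]; nlinarith [Real.exp_one_gt_two]
  -- The Gaussian exponents give `-A ε²/2`; the two errors `A ε²/8` leave `-A ε²/4 ≤ -2`. The same
  -- count serves `b3`.
  have b1 : Real.exp (ε * (A * y)) * M1 ≤ M2 / 4 := by
    calc _ = Real.exp (ε * (A * y) + Real.log M1) := by rw [Real.exp_add, Real.exp_log p1]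
      _ ≤ Real.exp (-2 + Real.log M2) := by apply Real.exp_le_exp.2; nlinarith
      _ = Real.exp (-2) * M2 := by rw [Real.exp_add, Real.exp_log p2]
      _ ≤ 1 / 4 * M2 := by gcongr
      _ = _ := by ring
  have b3 : Real.exp (-(ε * (A * (y + 2 * ε)))) * M3 ≤ M2 / 4 := by
    calc _ = Real.exp (-(ε * (A * (y + 2 * ε))) + Real.log M3) := by
            rw [Real.exp_add, Real.exp_log p3]
      _ ≤ Real.exp (-2 + Real.log M2) := by apply Real.exp_le_exp.2; nlinarith
      _ = Real.exp (-2) * M2 := by rw [Real.exp_add, Real.exp_log p2]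
      _ ≤ 1 / 4 * M2 := by gcongr
      _ = _ := by ring
  have bQ : M2 / 2 ≤ Real.exp ((y + ε) * (A * (y + 2 * ε))) * Q := by linarith
  have hQ : 0 < Q := by
    by_contra hQ
    nlinarith [Real.exp_pos ((y + ε) * (A * (y + 2 * ε)))]
  have upl := Real.log_le_log hQ up
  rw [Real.log_mul (Real.exp_ne_zero _) p1.ne', Real.log_exp] at upl
  have lowl := Real.log_le_log (by positivity) bQ
  rw [Real.log_mul (Real.exp_ne_zero _) hQ.ne', Real.log_exp,
    Real.log_div p2.ne' two_ne_zero] at lowl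
  have hlog2 : Real.log 2 ≤ A * ε ^ 2 / 8 := by
    have := Real.log_le_sub_one_of_pos (show (0 : ℝ) < 2 by norm_num)
    linarith
  -- The lower bound loses `A (2εy + 3ε²/2)`, plus `A ε²/8` each for the cumulant error and `log 2`;
  -- `y ≤ 2` and `ε ≤ 1` bring this below `6εA`.
  have k1 : A * ε ^ 2 ≤ A * ε := by
    have : ε ^ 2 ≤ ε := by nlinarith
    gcongr
  have k2 : A * (ε * y) ≤ A * (ε * 2) := by gcongr; linarith
  rw [abs_le]
  constructor
  · nlinarith
  · nlinarith [mul_pos hA hε]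

theorem sqrt_mul_le_V_iff (f : ℝ → ℝ) {θ : ℝ} (hσ : 0 < sigma0 f θ) {n : ℕ} (hn : 0 < n) (x : ℝ)
    (X : Fin n → ℝ) :
    Real.sqrt n * x ≤ V f θ n X ↔
      n * sigma0 f θ ^ 2 * (x / sigma0 f θ) ≤ ∑ i, (Real.log (p f θ (X i)) - e0 f θ) := by
  have hs : 0 < Real.sqrt n := Real.sqrt_pos.2 (by exact_mod_cast hn)
  have hss : Real.sqrt n * Real.sqrt n = n := Real.mul_self_sqrt (Nat.cast_nonneg n)
  rw [V, one_div_mul_eq_div, le_div_iff₀ (by positivity)]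
  have : Real.sqrt n * x * (Real.sqrt n * sigma0 f θ)
      = n * sigma0 f θ ^ 2 * (x / sigma0 f θ) := by
    field_simp
    rw [pow_two, hss, mul_comm]
  rw [this]

theorem abs_log_mgf_sum_sub_le {E : Type*} [MeasurableSpace E] {μ : Measure E}
    [IsProbabilityMeasure μ] (n : ℕ) {h c s κ : ℝ} {g : E → ℝ}
    (hg : Integrable (fun t => Real.exp (h * g t)) μ)
    (hκ : |Real.log (∫ t, Real.exp (h * g t) ∂μ) - h * c - h ^ 2 / 2 * s ^ 2| ≤ κ * s ^ 2) :
    |Real.log (ProbabilityTheory.mgf (fun X : Fin n → E => ∑ i, (g (X i) - c))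
      (Measure.pi fun _ => μ) h) - n * s ^ 2 * h ^ 2 / 2| ≤ κ * (n * s ^ 2) := by
  rw [log_mgf_sum_sub n c hg]
  have e : n * (Real.log (∫ t, Real.exp (h * g t) ∂μ) - h * c) - n * s ^ 2 * h ^ 2 / 2
      = n * (Real.log (∫ t, Real.exp (h * g t) ∂μ) - h * c - h ^ 2 / 2 * s ^ 2) := by ring
  rw [e, abs_mul, Nat.abs_cast]
  calc _ ≤ n * (κ * s ^ 2) := by gcongr
    _ = _ := by ring

theorem abs_log_tail_V_add_le {f : ℝ → ℝ} (hf : MemLp f 2 P0) (hf0 : ∀ᵐ t ∂P0, 0 ≤ f t)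
    {θ : ℝ} (hθ : θ ∈ Set.Ioo (0 : ℝ) 1) (hσ : 0 < sigma0 f θ) {n : ℕ} (hn : 0 < n) {ε y : ℝ}
    (hε : 0 < ε) (hε1 : ε ≤ 1) (hA : 8 ≤ n * sigma0 f θ ^ 2 * ε ^ 2) (hy : 0 ≤ y)
    (hy2 : y + 2 * ε ≤ 2)
    (hcgf : ∀ h, 0 ≤ h → h ≤ y + 2 * ε →
      |Real.log (∫ t, Real.exp (h * Real.log (p f θ t)) ∂P0) - h * e0 f θ
        - h ^ 2 / 2 * sigma0 f θ ^ 2| ≤ ε ^ 2 / 8 * sigma0 f θ ^ 2) :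
    |Real.log ((P0n n).real {X | Real.sqrt n * (y * sigma0 f θ) ≤ V f θ n X})
      + n * sigma0 f θ ^ 2 * y ^ 2 / 2| ≤ 6 * ε * (n * sigma0 f θ ^ 2) := by
  have hmeas : AEMeasurable (fun X : Fin n → ℝ => ∑ i, (Real.log (p f θ (X i)) - e0 f θ))
      (Measure.pi fun _ => P0) := by
    refine Finset.aemeasurable_fun_sum _ fun i _ => AEMeasurable.sub_const ?_ _
    exact (aestronglyMeasurable_log_p hf θ).aemeasurable.comp_quasiMeasurePreserving
      (Measure.quasiMeasurePreserving_eval _ i)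
  have hint := fun h (h0 : 0 ≤ h) (h2 : h ≤ y + 2 * ε) =>
    integrable_exp_mul_log_p hf hf0 hθ h0 (h2.trans hy2)
  have hset : {X | Real.sqrt n * (y * sigma0 f θ) ≤ V f θ n X}
      = {X | n * sigma0 f θ ^ 2 * y ≤ ∑ i, (Real.log (p f θ (X i)) - e0 f θ)} := by
    ext X
    simp only [Set.mem_ofPred_eq]
    rw [sqrt_mul_le_V_iff f hσ hn, mul_div_cancel_right₀ _ hσ.ne']
  rw [hset]
  have hn0 : (0 : ℝ) < n := by exact_mod_cast hn
  unfold P0n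
  exact abs_log_tail_add_le hmeas (by positivity) hε hε1 hA hy hy2
    (fun h h0 h1 => integrable_exp_mul_sum_sub n _ (g := fun t => Real.log (p f θ t)) (hint h h0 h1))
    (fun h h0 h1 => abs_log_mgf_sum_sub_le n (g := fun t => Real.log (p f θ t)) (hint h h0 h1) (hcgf h h0 h1))

end NPTest

/-! ### The limit -/

theorem proposition7
    (f : ℝ → ℝ) (hf_nonneg : ∀ᵐ t ∂NPTest.P0, 0 ≤ f t)
    (hf_int : ∫ t, f t ∂NPTest.P0 = 1) (hf_L2 : MemLp f 2 NPTest.P0)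
    (θ : ℕ → ℝ) (hθ : ∀ n, 1 ≤ n → θ n ∈ Set.Ioo (0 : ℝ) 1)
    (hθ_lim : Tendsto θ atTop (𝓝 0))
    (hnθ : Tendsto (fun n : ℕ => (n : ℝ) * θ n ^ 2) atTop atTop)
    (δ : ℝ) (hδ_pos : 0 < δ) (hδ_lt : δ < 1 / 2)
    (x : ℕ → ℝ)
    (hx : ∀ n, 1 ≤ n →
      2 * δ * NPTest.sigma0 f (θ n) < x n ∧ x n < 2 * (1 - δ) * NPTest.sigma0 f (θ n)) :
    Tendsto
      (fun n : ℕ => -(1 / ((n : ℝ) * x n ^ 2)) *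
        Real.log ((NPTest.P0n n).real {X | Real.sqrt n * x n ≤ NPTest.V f (θ n) n X}))
      atTop (𝓝 (1 / 2)) := by
  -- As `δ < 1/2`, the window for `x n` is empty unless `σ > 0`; this also rules out `f = 1` a.e.
  have hσ : ∀ n, 1 ≤ n → 0 < NPTest.sigma0 f (θ n) := fun n hn => by
    have h := hx n hn
    by_contra h0
    nlinarith
  have hG := NPTest.integral_sq_sub_one_pos hf_L2 (hσ 1 le_rfl).ne'
  have hpos : ∀ᶠ n in atTop, 0 < θ n := (eventually_ge_atTop 1).mono fun n hn => (hθ n hn).1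
  have hA : Tendsto (fun n : ℕ => (n : ℝ) * NPTest.sigma0 f (θ n) ^ 2) atTop atTop := by
    refine (hnθ.atTop_mul_pos hG
      (NPTest.tendsto_sigma0_sq_div hf_L2 hf_nonneg hf_int hpos hθ_lim)).congr' ?_
    filter_upwards [hpos] with n hn
    field_simp
  rw [Metric.tendsto_nhds]
  intro r hr
  -- The first bound keeps `y + 2ε ≤ 2 - δ`; the second gives `6ε ≤ 2rδ² < r y²`.
  set ε := min (δ / 2) (r * δ ^ 2 / 3) with hεdef
  have hε : 0 < ε := lt_min (by linarith) (by positivity)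
  have hεδ : ε ≤ δ / 2 := min_le_left _ _
  have hεr : ε ≤ r * δ ^ 2 / 3 := min_le_right _ _
  filter_upwards [eventually_ge_atTop 1, hA.eventually_ge_atTop (8 / ε ^ 2),
    NPTest.eventually_abs_log_integral_exp_sub_le hf_L2 hf_nonneg hf_int hG
      (H := 2 - δ) (by linarith) (by linarith) hpos hθ_lim (show 0 < ε ^ 2 / 8 by positivity)] with n hn hAn hcgf
  have hs := hσ n hn
  have hn0 : (0 : ℝ) < n := by exact_mod_cast hn
  set s := NPTest.sigma0 f (θ n)
  set A := (n : ℝ) * s ^ 2 with hAdef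
  have hApos : 0 < A := by positivity
  set y := x n / s with hy
  have hxy : x n = y * s := by rw [hy]; field_simp
  have hy1 : 2 * δ < y := by rw [hy, lt_div_iff₀ hs]; exact (hx n hn).1
  have hy2 : y < 2 * (1 - δ) := by rw [hy, div_lt_iff₀ hs]; exact (hx n hn).2
  have key := NPTest.abs_log_tail_V_add_le hf_L2 hf_nonneg (hθ n hn) hs hn hε (by linarith)
    (by rwa [div_le_iff₀ (by positivity)] at hAn) (y := y) (by linarith) (by linarith)
    (fun h h0 h1 => hcgf h h0 (by linarith))
  rw [← hxy] at key
  rw [Real.dist_eq]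
  generalize Real.log ((NPTest.P0n n).real _) = Λ at key ⊢
  have hden : (n : ℝ) * x n ^ 2 = A * y ^ 2 := by rw [hxy, hAdef]; ring
  have hy0 : 0 < y := by linarith
  have e : -(1 / (A * y ^ 2)) * Λ - 1 / 2 = -((Λ + A * y ^ 2 / 2) / (A * y ^ 2)) := by
    field_simp; ring
  rw [hden, e, abs_neg, abs_div, abs_of_pos (show 0 < A * y ^ 2 by positivity),
    div_lt_iff₀ (by positivity)]
  refine key.trans_lt ?_
  have h1 : 6 * ε ≤ r * (2 * δ ^ 2) := by linarith
  have h2 : 2 * δ ^ 2 < y ^ 2 := by nlinarith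
  have h3 : r * (2 * δ ^ 2) < r * y ^ 2 := by gcongr
  nlinarith
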